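/- **Setting.** Let $N\ge 1$, let $\mathcal D$ be a finite non-empty set (secrets), $\mathcal M$ a set (outer queries) and $\mathcal V$ a set (outputs). A permutation challenge game is given by a translation function $\mathrm{tr}:\mathcal D\times\mathcal M\to[N]$, a post-processing function $\mathrm{post}:\mathcal D\times[N]\to[N]$ and a $0/1$ success predicate $\mathrm{suc}$; a uniform permutation $\sigma$ of $[N]$ and an independent uniform secret $d\in\mathcal D$ are drawn. A query is an inner query $i\in[N]$, answered by $\sigma(i)$ (the game may also allow inner queries answered by $\sigma^{-1}(i)$), or an outer query $m\in\mathcal M$, answered by $\mathrm{post}(d,\sigma(\mathrm{tr}(d,m)))$. A (deterministic) non-adaptive algorithm fixes its queries in advance and outputs a value $v\in\mathcal V$ that is a function of the answers; it succeeds if $\mathrm{suc}$ holds. Let $\mathrm{MaxS}(T)$ be the optimal success probability of a non-adaptive algorithm (without preprocessing) making at most $T$ queries. A non-adaptive $(S,T)$ algorithm with preprocessing is a pair $(A_0,A_1)$, where $A_0$ maps $\sigma$ to an advice string $z\in\{0,1\}^S$ and, for every $z$, $(A_1)_z$ is a non-adaptive algorithm making at most $T$ queries; its success probability is the probability that $(A_1)_{A_0(\sigma)}$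 succeeds. The function $\mathrm{tr}$ is $u$-uniform ($u>0$ real) if $|\{d\in\mathcal D:\mathrm{tr}(d,m)=j\}|\le|\mathcal D|/u$ for all $m\in\mathcal M$, $j\in[N]$. **Theorem.** Suppose that $\mathrm{tr}$ is $u$-uniform, that $\mathrm{post}(d,j)=j$ for all $d,j$, and that $\mathrm{suc}$ compares the output of the algorithm with the secret, i.e. whether it holds depends only on $d$ and on the output $v$ (for instance $v=g(d)$ for a fixed function $g$). Then every non-adaptive $(S,T)$ algorithm with preprocessing has success probability at most $$\min\left(2\,\mathrm{MaxS}(T)+\frac{4\ln(2)\,ST}{u},\ \ \mathrm{MaxS}(T)+\sqrt{\frac{\ln(2)\,ST}{u}}\right).$$ -/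

import Mathlib

/-- A query of an adversary in a permutation challenge game over `[N]` (modelled by `Fin N`) with
outer query space `M`: an inner query to the permutation, an inner query to its inverse, or an
outer query. -/
inductive PCQuery (N : ℕ) (M : Type*) where
  | inner (i : Fin N)
  | inverse (j : Fin N)
  | outer (m : M)

/-- A permutation challenge game over `[N]` with secret space `D`, outer query space `M` and
output domain `V` of the adversary. -/
structure PCGame (N : ℕ) (D M V : Type*) where
  /-- the translation function -/
  tr : D → M → Fin N
  /-- the post-processing function -/
  post : D → Fin N → Fin N
  /-- the 0/1 success predicate: it receives the secret, the output of the adversary and the list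
  of all query answers obtained by the adversary (and never the advice string) -/
  suc : D → V → List (Fin N) → Bool
  /-- whether inner queries to the inverse permutation are allowed in the game -/
  allowInverse : Bool

/-- A deterministic non-adaptive algorithm: its queries are fixed in advance, and its output is a
function of the answers. -/
structure NonadaptiveAlg (N : ℕ) (M V : Type*) where
  numQueries : ℕ
  query : Fin numQueries → PCQuery N M
  output : (Fin numQueries → Fin N) → V

/-- A pair `(A₀, A₁)` of a preprocessing algorithm with `S` bits of advice, which sees the whole
permutation, and a non-adaptive online algorithm, whose queries are fixed by the advice string. -/
structure PreprocessingAlg (N S : ℕ) (M V : Type*) where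
  advice : Equiv.Perm (Fin N) → (Fin S → Bool)
  online : (Fin S → Bool) → NonadaptiveAlg N M V

namespace PCGame

variable {N : ℕ} {D M V : Type*}

/-- `tr` is `u`-uniform: `|{d | tr(d, m) = j}| ≤ |D| / u` for all `m` and `j`. -/
def IsUniform [Fintype D] (G : PCGame N D M V) (u : ℝ) : Prop :=
  ∀ (m : M) (j : Fin N),
    ((Finset.univ.filter fun d : D => G.tr d m = j).card : ℝ) ≤ (Fintype.card D : ℝ) / u

/-- The post-processing function is trivial. -/
def TrivialPost (G : PCGame N D M V) : Prop :=
  ∀ (d : D) (j : Fin N), G.post d j = j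

/-- The success predicate only compares the output of the adversary with the secret; it does not
look at the query answers. -/
def ComparesOutputWithSecret (G : PCGame N D M V) : Prop :=
  ∃ P : D → V → Bool, ∀ (d : D) (v : V) (a : List (Fin N)), G.suc d v a = P d v

/-- The oracle answer to a query, for the permutation `σ` and the secret `d`. -/
def answer (G : PCGame N D M V) (σ : Equiv.Perm (Fin N)) (d : D) : PCQuery N M → Fin N
  | .inner i => σ i
  | .inverse j => σ.symm j
  | .outer m => G.post d (σ (G.tr d m))

/-- The answers obtained by the algorithm `B`. -/
def answers (G : PCGame N D M V) (B : NonadaptiveAlg N M V) (σ : Equiv.Perm (Fin N)) (d : D) :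
    Fin B.numQueries → Fin N :=
  fun i => G.answer σ d (B.query i)

/-- Whether `B` succeeds against the permutation `σ` and the secret `d`. -/
def succeeds (G : PCGame N D M V) (B : NonadaptiveAlg N M V) (σ : Equiv.Perm (Fin N)) (d : D) :
    Bool :=
  G.suc d (B.output (G.answers B σ d)) (List.ofFn (G.answers B σ d))

/-- `B` is an algorithm for the game `G` with at most `T` queries: inverse queries occur only if
the game allows them. -/
def IsAlg (G : PCGame N D M V) (T : ℕ) (B : NonadaptiveAlg N M V) : Prop :=
  B.numQueries ≤ T ∧
    ∀ (i : Fin B.numQueries) (j : Fin N), B.query i = PCQuery.inverse j → G.allowInverse = true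

/-- `A` is an `(S, T)` algorithm with preprocessing for `G`: for every advice string (of `S` bits)
the online algorithm makes at most `T` queries. -/
def IsPreprocessingAlg (G : PCGame N D M V) {S : ℕ} (T : ℕ) (A : PreprocessingAlg N S M V) :
    Prop :=
  ∀ z : Fin S → Bool, G.IsAlg T (A.online z)

/-- The success probability of `B`, for a uniform permutation and an independent uniform
secret. -/
noncomputable def successProb [Fintype D] (G : PCGame N D M V) (B : NonadaptiveAlg N M V) : ℝ :=
  ((Finset.univ.filter fun x : Equiv.Perm (Fin N) × D =>
      G.succeeds B x.1 x.2 = true).card : ℝ) /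
    (Fintype.card (Equiv.Perm (Fin N) × D) : ℝ)

/-- The success probability of `(A₀, A₁)`, for a uniform permutation and an independent uniform
secret: `A₁` is run with the advice `A₀(σ)`. -/
noncomputable def preprocessingSuccessProb [Fintype D] (G : PCGame N D M V) {S : ℕ}
    (A : PreprocessingAlg N S M V) : ℝ :=
  ((Finset.univ.filter fun x : Equiv.Perm (Fin N) × D =>
      G.succeeds (A.online (A.advice x.1)) x.1 x.2 = true).card : ℝ) /
    (Fintype.card (Equiv.Perm (Fin N) × D) : ℝ)

/-- `MaxS(T)`: the optimal success probability of a non-preprocessing, non-adaptive algorithm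
with at most `T` queries. -/
noncomputable def maxS [Fintype D] (G : PCGame N D M V) (T : ℕ) : ℝ :=
  sSup {p : ℝ | ∃ B : NonadaptiveAlg N M V, G.IsAlg T B ∧ G.successProb B = p}

end PCGame

/-! For a fixed advice string `z`, let `Y z σ` be a multiple of the number of secrets for which the
online algorithm succeeds against `σ`. If `Y z` has a small exponential moment for every `z`, then
summing over the `2 ^ S` strings bounds that of `Y (A.advice σ) σ`, and Jensen turns this into a
bound on its mean: advice costs only `S * log 2` in the exponent.

For the moment bound, condition on what the inner queries reveal. Since `post` is trivial, success
for the secret `d` then depends only on `σ` restricted to the outer positions of `d`; by uniformity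
each position is read for at most `k = T * |D| / u` secrets. So `log_classAverage_exp_sum_le`, a
Shearer-type inequality with weight `1 / (2 * k)`, separates the secrets. Each factor is Bernoulli,
and the conditional success probabilities average to at most `maxS`, because an algorithm without
advice can relabel values to simulate any conditioning (`sum_classAverage_success_le`).

The values of a permutation are dependent, and this is what the factor 2 in the weight pays for.
Revealing the position of one value at a time reduces the inequality to functions `L d` on a finite
set, each constant off `A d`. By Gibbs duality this becomes a bound on the entropies of one density
averaged off each `A d`. The part on `A d` costs one `k`; the part off `A d` is charged back to `A
d` by `exists_klFun_redistribution` and costs another. -/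

/-! ### Entropy inequalities on a finite set -/

open InformationTheory in
/-- A Jensen inequality for `klFun`, in which only the points of `S` are charged. -/
theorem card_mul_klFun_average_le {ι : Type*} [DecidableEq ι] {B S : Finset ι} (hS : S ⊆ B)
    (hB : B.Nonempty) {x : ι → ℝ} (hx : ∀ i ∈ B, 0 ≤ x i) {θ : ℝ} (h0 : 0 ≤ θ) (h1 : θ ≤ 1)
    (h : ∑ i ∈ B, (x i - 1) = θ * ∑ i ∈ S, (x i - 1)) :
    (B.card : ℝ) * klFun ((∑ i ∈ B, x i) / B.card) ≤ θ * ∑ i ∈ S, klFun (x i) := by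
  have hb : (0 : ℝ) < B.card := by exact_mod_cast hB.card_pos
  -- `y` has the same sum on `B` as `x`, but differs from 1 only on `S`. Jensen on `B`, then
  -- convexity between `x i` and 1 with `klFun 1 = 0`, gives the factor `θ`.
  set y : ι → ℝ := fun i => if i ∈ S then θ * x i + (1 - θ) * 1 else 1 with hy
  have hsum : ∑ i ∈ B, y i = ∑ i ∈ B, x i := by
    have h2 : ∑ i ∈ B, (y i - 1) = θ * ∑ i ∈ S, (x i - 1) := by
      rw [Finset.mul_sum, ← Finset.sum_subset hS (f := fun i => y i - 1)]
      · refine Finset.sum_congr rfl fun i hi => ?_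
        simp only [hy, hi, if_true]; ring
      · intro i _ hi
        simp [hy, hi]
    rw [← h, Finset.sum_sub_distrib, Finset.sum_sub_distrib] at h2
    linarith
  have hJ := convexOn_klFun.map_sum_le (t := B) (w := fun _ => (B.card : ℝ)⁻¹) (p := y)
    (fun _ _ => by positivity) (by simp [hb.ne'])
    (fun i hi => by
      have := hx i hi
      simp only [hy, Set.mem_Ici]
      split_ifs
      · nlinarith
      · norm_num)
  simp only [smul_eq_mul, ← Finset.mul_sum, hsum] at hJ
  have hpt : ∑ i ∈ B, klFun (y i) ≤ θ * ∑ i ∈ S, klFun (x i) := by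
    rw [Finset.mul_sum, ← Finset.sum_subset hS (f := fun i => klFun (y i))]
    · refine Finset.sum_le_sum fun i hi => ?_
      have := convexOn_klFun.2 (x := x i) (y := 1) (hx i (hS hi)) (by simp) h0
        (sub_nonneg.2 h1) (by ring)
      simpa [hy, hi, klFun_one] using this
    · intro i _ hi
      simp [hy, hi, klFun_one]
  rw [div_eq_inv_mul]
  calc (B.card : ℝ) * klFun ((B.card : ℝ)⁻¹ * ∑ i ∈ B, x i)
      ≤ B.card * ((B.card : ℝ)⁻¹ * ∑ i ∈ B, klFun (y i)) := by gcongr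
    _ = ∑ i ∈ B, klFun (y i) := by field_simp
    _ ≤ _ := hpt

open InformationTheory in
/-- The total `klFun`-mass of a density `x` on `J` can be redistributed in such a way that every
set `J \ B` receives at least the mass of the average of `x` over `B`. -/
theorem exists_klFun_redistribution {ι : Type*} [DecidableEq ι] {J : Finset ι} {x : ι → ℝ}
    (hx : ∀ i ∈ J, 0 ≤ x i) (hsum : ∑ i ∈ J, x i = J.card) :
    ∃ r : ι → ℝ, (∀ i, 0 ≤ r i) ∧ ∑ i ∈ J, r i ≤ ∑ i ∈ J, klFun (x i) ∧
      ∀ B ⊆ J, (B.card : ℝ) * klFun ((∑ i ∈ B, x i) / B.card) ≤ ∑ i ∈ J \ B, r i := by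
  set P : ℝ := ∑ i ∈ J with 1 < x i, klFun (x i) with hP
  set Q : ℝ := ∑ i ∈ J with x i < 1, klFun (x i) with hQ
  set s : ℝ := ∑ i ∈ J with 1 < x i, (x i - 1) with hs
  have hk : ∀ i ∈ J, 0 ≤ klFun (x i) := fun i hi => klFun_nonneg (hx i hi)
  have hP0 : 0 ≤ P := Finset.sum_nonneg fun i hi => hk i (Finset.mem_filter.1 hi).1
  have hQ0 : 0 ≤ Q := Finset.sum_nonneg fun i hi => hk i (Finset.mem_filter.1 hi).1
  have split : ∀ B : Finset ι, ∑ i ∈ B, (x i - 1) =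
      ∑ i ∈ B with 1 < x i, (x i - 1) - ∑ i ∈ B with x i < 1, (1 - x i) := by
    intro B
    rw [Finset.sum_filter, Finset.sum_filter, ← Finset.sum_sub_distrib]
    refine Finset.sum_congr rfl fun i _ => ?_
    split_ifs <;> linarith
  have hs' : ∑ i ∈ J with x i < 1, (1 - x i) = s := by
    have := split J
    rw [Finset.sum_sub_distrib, hsum] at this
    simp only [Finset.sum_const, nsmul_eq_mul, mul_one] at this
    linarith
  have hup : ∀ B : Finset ι, 0 ≤ ∑ i ∈ B with 1 < x i, (x i - 1) := fun B =>
    Finset.sum_nonneg fun i hi => by linarith [(Finset.mem_filter.1 hi).2]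
  have hdn : ∀ B : Finset ι, 0 ≤ ∑ i ∈ B with x i < 1, (1 - x i) := fun B =>
    Finset.sum_nonneg fun i hi => by linarith [(Finset.mem_filter.1 hi).2]
  have hs0 : 0 ≤ s := hup J
  -- The charge is crossed: the entropy `P` of the points above 1 goes to the points below 1 in
  -- proportion to their deficit, and `Q` goes to the points above 1 in proportion to their excess.
  -- Total excess and total deficit both equal `s`. If `s = 0`, division by zero makes `r = 0`.
  set r : ι → ℝ := fun i => (if x i < 1 then (1 - x i) else 0) * (P / s) +
    (if 1 < x i then (x i - 1) else 0) * (Q / s) with hr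
  have hrsum : ∀ B : Finset ι, ∑ i ∈ B, r i =
      (∑ i ∈ B with x i < 1, (1 - x i)) * (P / s) +
        (∑ i ∈ B with 1 < x i, (x i - 1)) * (Q / s) := by
    intro B
    rw [Finset.sum_filter, Finset.sum_filter, Finset.sum_mul, Finset.sum_mul,
      ← Finset.sum_add_distrib]
  refine ⟨r, fun i => ?_, ?_, fun B hB => ?_⟩
  · simp only [hr]
    have := div_nonneg hP0 hs0
    have := div_nonneg hQ0 hs0
    refine add_nonneg (mul_nonneg ?_ ‹_›) (mul_nonneg ?_ ‹_›) <;> split_ifs <;> linarith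
  · rw [hrsum, hs', ← hs]
    have hPQ : P + Q ≤ ∑ i ∈ J, klFun (x i) := by
      rw [hP, hQ, Finset.sum_filter, Finset.sum_filter, ← Finset.sum_add_distrib]
      refine Finset.sum_le_sum fun i hi => ?_
      have := hk i hi
      split_ifs <;> linarith
    refine le_trans ?_ hPQ
    have : ∀ K, 0 ≤ K → s * (K / s) ≤ K := fun K hK => by
      rcases hs0.eq_or_lt with h | h
      · simpa [← h] using hK
      · exact (mul_div_cancel₀ K h.ne').le
    linarith [this P hP0, this Q hQ0]
  · rcases B.eq_empty_or_nonempty with rfl | hne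
    · have := hrsum J
      simp only [Finset.card_empty, Nat.cast_zero, zero_mul, Finset.sdiff_empty, this]
      have := div_nonneg hP0 hs0
      have := div_nonneg hQ0 hs0
      have := hup J
      have := hdn J
      positivity
    have hxB : ∀ i ∈ B, 0 ≤ x i := fun i hi => hx i (hB hi)
    set p : ℝ := ∑ i ∈ B with 1 < x i, (x i - 1) with hp
    set q : ℝ := ∑ i ∈ B with x i < 1, (1 - x i) with hq
    have hpB := split B
    have hup' : ∑ i ∈ J \ B with 1 < x i, (x i - 1) = s - p := by
      rw [eq_sub_iff_add_eq, hs, hp, Finset.sum_filter, Finset.sum_filter, Finset.sum_filter,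
        Finset.sum_sdiff hB]
    have hdn' : ∑ i ∈ J \ B with x i < 1, (1 - x i) = s - q := by
      rw [eq_sub_iff_add_eq, ← hs', hq, Finset.sum_filter, Finset.sum_filter, Finset.sum_filter,
        Finset.sum_sdiff hB]
    have hps : 0 ≤ s - p := hup' ▸ hup _
    have hqs : 0 ≤ s - q := hdn' ▸ hdn _
    have hp0 : 0 ≤ p := hup B
    have hq0 : 0 ≤ q := hdn B
    have hPB : ∑ i ∈ B with 1 < x i, klFun (x i) ≤ P :=
      Finset.sum_le_sum_of_subset_of_nonneg (Finset.filter_subset_filter _ hB)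
        fun i hi _ => hk i (Finset.mem_filter.1 hi).1
    have hQB : ∑ i ∈ B with x i < 1, klFun (x i) ≤ Q :=
      Finset.sum_le_sum_of_subset_of_nonneg (Finset.filter_subset_filter _ hB)
        fun i hi _ => hk i (Finset.mem_filter.1 hi).1
    rw [hrsum, hup', hdn']
    have key : ∀ {p q K : ℝ}, 0 ≤ p → p ≤ q → 0 ≤ s - q → 0 ≤ K → 0 < q →
        (1 - p / q) * K ≤ (s - p) * (K / s) := by
      intro p q K hp hpq hqs hK hq
      have hs : 0 < s := by linarith
      have : (s - p) * (K / s) = (1 - p / s) * K := by field_simp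
      rw [this]
      have : p / s ≤ p / q := div_le_div_of_nonneg_left hp hq (by linarith)
      gcongr
    have hPs := div_nonneg hP0 hs0
    have hQs := div_nonneg hQ0 hs0
    -- If deficit dominates on `B`, cancelling it against the excess leaves the fraction `1 - p / q`
    -- of the entropy below 1, at most `(1 - p / s) * Q`. This is the share of `Q` sent to `J \ B`,
    -- whose excess is `s - p`. The other case is symmetric.
    rcases le_total p q with hpq | hpq
    · rcases hq0.eq_or_lt with h | h
      · have h3 := card_mul_klFun_average_le (Finset.empty_subset B) hne hxB le_rfl zero_le_one
          (by rw [hpB, ← hp, ← hq, Finset.sum_empty]; linarith)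
        simp only [Finset.sum_empty, mul_zero] at h3
        refine h3.trans ?_
        positivity
      · have hθ : 0 ≤ 1 - p / q := sub_nonneg.2 (div_le_one_of_le₀ hpq hq0)
        have h3 := card_mul_klFun_average_le (Finset.filter_subset (fun i => x i < 1) B) hne hxB hθ
          (by linarith [div_nonneg hp0 hq0]) (by
            have : ∑ i ∈ B with x i < 1, (x i - 1) = -q := by
              rw [hq, ← Finset.sum_neg_distrib]; simp
            rw [this, hpB]; field_simp; ring)
        have h4 := key hp0 hpq hqs hQ0 h
        have := mul_le_mul_of_nonneg_left hQB hθ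
        have := mul_nonneg hqs hPs
        linarith
    · rcases hp0.eq_or_lt with h | h
      · have h3 := card_mul_klFun_average_le (Finset.empty_subset B) hne hxB le_rfl zero_le_one
          (by rw [hpB, ← hp, ← hq, Finset.sum_empty]; linarith)
        simp only [Finset.sum_empty, mul_zero] at h3
        refine h3.trans ?_
        positivity
      · have hθ : 0 ≤ 1 - q / p := sub_nonneg.2 (div_le_one_of_le₀ hpq hp0)
        have h3 := card_mul_klFun_average_le (Finset.filter_subset (fun i => 1 < x i) B) hne hxB hθ
          (by linarith [div_nonneg hq0 hp0]) (by
            rw [hpB, ← hp, ← hq]; field_simp)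
        have h4 := key hq0 hpq hps hP0 h
        have := mul_le_mul_of_nonneg_left hPB hθ
        have := mul_nonneg hps hQs
        linarith

/-- The Gibbs variational inequality on a finite set. -/
theorem sum_mul_sub_card_mul_log_le {ι : Type*} {J : Finset ι} (hJ : J.Nonempty) {x L : ι → ℝ}
    (hx : ∀ i ∈ J, 0 < x i) (hsum : ∑ i ∈ J, x i = J.card) :
    ∑ i ∈ J, x i * L i - J.card * Real.log ((∑ i ∈ J, Real.exp (L i)) / J.card) ≤
      ∑ i ∈ J, InformationTheory.klFun (x i) := by
  have hc : (0 : ℝ) < J.card := by exact_mod_cast hJ.card_pos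
  have hE : 0 < ∑ i ∈ J, Real.exp (L i) := Finset.sum_pos (fun i _ => Real.exp_pos _) hJ
  set c := Real.log ((∑ i ∈ J, Real.exp (L i)) / J.card) with hcdef
  have hexpc : Real.exp c = (∑ i ∈ J, Real.exp (L i)) / J.card := Real.exp_log (by positivity)
  have hpt : ∀ i ∈ J, x i * L i - x i * c - InformationTheory.klFun (x i) ≤
      Real.exp (L i) / Real.exp c - 1 := by
    intro i hi
    have h0 := hx i hi
    have h1 := Real.log_le_sub_one_of_pos (x := Real.exp (L i - c) / x i) (by positivity)
    rw [Real.log_div (by positivity) h0.ne', Real.log_exp] at h1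
    have h2 := mul_le_mul_of_nonneg_left h1 h0.le
    rw [mul_sub, mul_sub, mul_sub, mul_div_cancel₀ _ h0.ne', Real.exp_sub] at h2
    simp only [InformationTheory.klFun]
    nlinarith
  have := Finset.sum_le_sum hpt
  rw [Finset.sum_sub_distrib, Finset.sum_sub_distrib, Finset.sum_sub_distrib, ← Finset.sum_mul,
    ← Finset.sum_div, hsum, hexpc] at this
  have h5 : (∑ i ∈ J, Real.exp (L i)) / ((∑ i ∈ J, Real.exp (L i)) / J.card) = J.card := by
    field_simp
  rw [h5] at this
  simp at this
  linarith

-- Averaging `x` off `A` does not change its pairing with `L`, so the Gibbs inequality may be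
-- applied to the averaged density, which has smaller entropy.
open InformationTheory in
theorem sum_mul_sub_card_mul_log_le_of_const {ι : Type*} [DecidableEq ι] {J A : Finset ι}
    (hJ : J.Nonempty) {x L : ι → ℝ} (hx : ∀ i ∈ J, 0 < x i) (hsum : ∑ i ∈ J, x i = J.card)
    (hL : ∀ i ∈ J, ∀ j ∈ J, i ∉ A → j ∉ A → L i = L j) :
    ∑ i ∈ J, x i * L i - J.card * Real.log ((∑ i ∈ J, Real.exp (L i)) / J.card) ≤
      ∑ i ∈ J with i ∈ A, klFun (x i) +
        ((J.filter (· ∉ A)).card : ℝ) *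
          klFun ((∑ i ∈ J with i ∉ A, x i) / (J.filter (· ∉ A)).card) := by
  set B := J.filter (· ∉ A) with hB
  set y := (∑ i ∈ B, x i) / B.card with hy
  have hyB : ∀ c : ℝ, ∑ i ∈ B, y * c = ∑ i ∈ B, x i * c := by
    intro c
    rcases B.eq_empty_or_nonempty with h | h
    · simp [h]
    · have : (0 : ℝ) < B.card := by exact_mod_cast h.card_pos
      rw [Finset.sum_const, nsmul_eq_mul, ← Finset.sum_mul, hy]
      field_simp
  set x' : ι → ℝ := fun i => if i ∈ A then x i else y with hx'
  have hsplit : ∀ f : ι → ℝ, ∑ i ∈ J, f i = ∑ i ∈ J with i ∈ A, f i + ∑ i ∈ B, f i :=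
    fun f => (Finset.sum_filter_add_sum_filter_not J (· ∈ A) f).symm
  have hin : ∀ f : ι → ℝ → ℝ, ∑ i ∈ J with i ∈ A, f i (x' i) = ∑ i ∈ J with i ∈ A, f i (x i) :=
    fun f => Finset.sum_congr rfl fun i hi => by simp [hx', (Finset.mem_filter.1 hi).2]
  have hout : ∀ f : ι → ℝ → ℝ, ∑ i ∈ B, f i (x' i) = ∑ i ∈ B, f i y :=
    fun f => Finset.sum_congr rfl fun i hi => by simp [hx', (Finset.mem_filter.1 hi).2]
  have h1 := sum_mul_sub_card_mul_log_le hJ (x := x') (L := L)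
    (by
      intro i hi
      simp only [hx']
      split_ifs with h
      · exact hx i hi
      · have hiB : i ∈ B := Finset.mem_filter.2 ⟨hi, h⟩
        have : (0 : ℝ) < B.card := by exact_mod_cast Finset.card_pos.2 ⟨i, hiB⟩
        exact div_pos (Finset.sum_pos (fun j hj => hx j (Finset.mem_filter.1 hj).1) ⟨i, hiB⟩) this)
    (by
      rw [← hsum, hsplit, hsplit x, hin (fun _ t => t), hout (fun _ t => t)]
      simpa using hyB 1)
  have h2 : ∑ i ∈ J, x' i * L i = ∑ i ∈ J, x i * L i := by
    rw [hsplit, hsplit (fun i => x i * L i), hin (fun i t => t * L i), hout (fun i t => t * L i)]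
    congr 1
    rcases B.eq_empty_or_nonempty with h | ⟨j, hj⟩
    · simp [h]
    · have : ∀ i ∈ B, L i = L j := fun i hi => by
        rw [hB, Finset.mem_filter] at hi hj
        exact hL i hi.1 j hj.1 hi.2 hj.2
      calc ∑ i ∈ B, y * L i = ∑ i ∈ B, y * L j :=
            Finset.sum_congr rfl fun i hi => by rw [this i hi]
        _ = ∑ i ∈ B, x i * L j := hyB _
        _ = ∑ i ∈ B, x i * L i := Finset.sum_congr rfl fun i hi => by rw [this i hi]
  have h3 : ∑ i ∈ J, klFun (x' i) = ∑ i ∈ J with i ∈ A, klFun (x i) + B.card * klFun y := by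
    rw [hsplit, hin (fun _ t => klFun t), hout (fun _ t => klFun t), Finset.sum_const,
      nsmul_eq_mul]
  rw [h2, h3] at h1
  exact h1

open InformationTheory in
/-- A Hölder type inequality for functions `L d` on `J` which are constant outside of `A d`. -/
theorem log_average_exp_sum_le {ι D : Type*} [DecidableEq ι] [Fintype D] {J : Finset ι}
    (hJ : J.Nonempty) (A : D → Finset ι) (L : D → ι → ℝ)
    (hL : ∀ d, ∀ i ∈ J, ∀ j ∈ J, i ∉ A d → j ∉ A d → L d i = L d j) {k : ℝ} (hk : 0 < k)
    (hcov : ∀ i ∈ J, ((Finset.univ.filter fun d => i ∈ A d).card : ℝ) ≤ k) :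
    Real.log ((∑ i ∈ J, Real.exp ((∑ d, L d i) / (2 * k))) / J.card) ≤
      (∑ d, Real.log ((∑ i ∈ J, Real.exp (L d i)) / J.card)) / (2 * k) := by
  have hc : (0 : ℝ) < J.card := by exact_mod_cast hJ.card_pos
  set E : ι → ℝ := fun i => Real.exp ((∑ d, L d i) / (2 * k)) with hE
  have hEpos : 0 < ∑ i ∈ J, E i := Finset.sum_pos (fun i _ => Real.exp_pos _) hJ
  set Z := (∑ i ∈ J, E i) / J.card with hZ
  have hZpos : 0 < Z := by positivity
  -- The tilted density, the equality case of the Gibbs inequality for the left-hand side. The same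
  -- `x` is then tested against every `L d`.
  set x : ι → ℝ := fun i => E i / Z with hxdef
  have hx : ∀ i ∈ J, 0 < x i := fun i _ => div_pos (Real.exp_pos _) hZpos
  have hsum : ∑ i ∈ J, x i = J.card := by
    rw [hxdef, ← Finset.sum_div, hZ]; field_simp
  obtain ⟨r, hr0, hrs, hrB⟩ := exists_klFun_redistribution (fun i hi => (hx i hi).le) hsum
  have hd := fun d => (sum_mul_sub_card_mul_log_le_of_const hJ hx hsum (hL d)).trans
    (add_le_add_right (hrB _ (Finset.filter_subset _ _)) _)
  have hcomp : ∀ d, J \ J.filter (· ∉ A d) = J.filter (· ∈ A d) := by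
    intro d; ext i; simp; tauto
  simp only [hcomp] at hd
  have hswap : ∀ f : ι → ℝ, (∀ i ∈ J, 0 ≤ f i) →
      ∑ d, ∑ i ∈ J with i ∈ A d, f i ≤ k * ∑ i ∈ J, f i := by
    intro f hf
    simp_rw [Finset.sum_filter]
    rw [Finset.sum_comm, Finset.mul_sum]
    refine Finset.sum_le_sum fun i hi => ?_
    rw [← Finset.sum_filter, Finset.sum_const, nsmul_eq_mul]
    exact mul_le_mul_of_nonneg_right (hcov i hi) (hf i hi)
  have htot := Finset.sum_le_sum fun d (_ : d ∈ Finset.univ) => hd d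
  rw [Finset.sum_add_distrib, Finset.sum_sub_distrib, ← Finset.mul_sum] at htot
  have hk1 := hswap (fun i => klFun (x i)) fun i hi => klFun_nonneg (hx i hi).le
  have hk2 := hswap r fun i _ => hr0 i
  have hk3 := mul_le_mul_of_nonneg_left hrs hk.le
  have hlog : ∀ i, (∑ d, L d i) = 2 * k * (Real.log (x i) + Real.log Z) := by
    intro i
    rw [hxdef]
    simp only
    rw [Real.log_div (Real.exp_pos _).ne' hZpos.ne', Real.log_exp]
    field_simp; ring
  have hkl : ∑ i ∈ J, klFun (x i) = ∑ i ∈ J, x i * Real.log (x i) := by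
    simp only [klFun, Finset.sum_sub_distrib, Finset.sum_add_distrib, hsum]; simp
  have hlin : ∑ d, ∑ i ∈ J, x i * L d i =
      2 * k * (∑ i ∈ J, klFun (x i) + J.card * Real.log Z) := by
    rw [Finset.sum_comm, hkl, ← hsum, Finset.sum_mul, ← Finset.sum_add_distrib, Finset.mul_sum]
    refine Finset.sum_congr rfl fun i _ => ?_
    rw [← Finset.mul_sum, hlog]; ring
  rw [le_div_iff₀ (by positivity)]
  refine le_of_mul_le_mul_left ?_ hc
  linarith

/-! ### Bernoulli exponential moments -/

open ProbabilityTheory MeasureTheory in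
/-- Hoeffding's lemma for a Bernoulli variable. -/
theorem log_one_add_mul_exp_sub_one_le {q l : ℝ} (h0 : 0 ≤ q) (h1 : q ≤ 1) :
    Real.log (1 + q * (Real.exp l - 1)) ≤ l * q + l ^ 2 / 8 := by
  set X : Bool → ℝ := fun b => cond b 1 0 with hX
  have h := hasSubgaussianMGF_of_mem_Icc (μ := bernoulliMeasure true false ⟨q, h0, h1⟩) (X := X)
    (a := 0) (b := 1) (measurable_of_finite _).aemeasurable
    (Filter.Eventually.of_forall fun b => by cases b <;> simp [hX])
  have h2 := h.mgf_le l
  simp only [mgf, integral_bernoulliMeasure] at h2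
  have h3 : Real.exp (-(l * q)) * (1 + q * (Real.exp l - 1)) ≤ Real.exp (l ^ 2 / 8) := by
    refine le_trans (le_of_eq ?_) (h2.trans (le_of_eq ?_))
    · have : Real.exp (l - l * q) = Real.exp l * Real.exp (-(l * q)) := by
        rw [← Real.exp_add, sub_eq_add_neg]
      simp [hX, mul_sub, this]
      ring
    · congr 1
      simp
      ring
  have hpos : 0 < 1 + q * (Real.exp l - 1) := by
    rcases h1.eq_or_lt with rfl | h1
    · simpa using Real.exp_pos l
    · nlinarith [mul_nonneg h0 (Real.exp_pos l).le]
  rw [← Real.exp_log hpos, ← Real.exp_add, Real.exp_le_exp] at h3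
  linarith

/-! ### Conditioning permutations and the Shearer-type inequality -/

open Equiv in
/-- The permutations which agree with `σ` on `I`. -/
def permClass {α : Type*} [Fintype α] [DecidableEq α] (I : Finset α) (σ : Perm α) :
    Finset (Perm α) :=
  Finset.univ.filter fun τ => ∀ i ∈ I, τ i = σ i

open Equiv in
/-- The average of `X` over the permutations which agree with `σ` on `I`. -/
noncomputable def classAverage {α : Type*} [Fintype α] [DecidableEq α] (I : Finset α) (σ : Perm α)
    (X : Perm α → ℝ) : ℝ :=
  (∑ τ ∈ permClass I σ, X τ) / (permClass I σ).card

section PermClass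

open Equiv

variable {α : Type*} [Fintype α] [DecidableEq α] {I : Finset α} {σ τ : Perm α}

theorem mem_permClass : τ ∈ permClass I σ ↔ ∀ i ∈ I, τ i = σ i := by simp [permClass]

theorem self_mem_permClass : σ ∈ permClass I σ := by simp [permClass]

theorem card_permClass_pos : (0 : ℝ) < (permClass I σ).card := by
  exact_mod_cast Finset.card_pos.2 ⟨σ, self_mem_permClass⟩

theorem permClass_eq_of_mem (h : τ ∈ permClass I σ) : permClass I τ = permClass I σ := by
  rw [mem_permClass] at h
  ext ρ
  simp only [mem_permClass]
  exact forall₂_congr fun i hi => by rw [h i hi]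

theorem classAverage_mono {X Y : Perm α → ℝ} (h : ∀ τ ∈ permClass I σ, X τ ≤ Y τ) :
    classAverage I σ X ≤ classAverage I σ Y :=
  div_le_div_of_nonneg_right (Finset.sum_le_sum h) (Nat.cast_nonneg _)

theorem classAverage_congr {X Y : Perm α → ℝ} (h : ∀ τ ∈ permClass I σ, X τ = Y τ) :
    classAverage I σ X = classAverage I σ Y := by
  rw [classAverage, classAverage, Finset.sum_congr rfl h]

theorem classAverage_pos {X : Perm α → ℝ} (h : ∀ τ, 0 < X τ) : 0 < classAverage I σ X :=
  div_pos (Finset.sum_pos (fun τ _ => h τ) ⟨σ, self_mem_permClass⟩) card_permClass_pos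

theorem classAverage_const (c : ℝ) : classAverage I σ (fun _ => c) = c := by
  have := card_permClass_pos (I := I) (σ := σ)
  rw [classAverage, Finset.sum_const, nsmul_eq_mul]; field_simp

theorem classAverage_sum {ι : Type*} (s : Finset ι) (X : ι → Perm α → ℝ) :
    classAverage I σ (fun τ => ∑ d ∈ s, X d τ) = ∑ d ∈ s, classAverage I σ (X d) := by
  simp only [classAverage]
  rw [Finset.sum_comm, Finset.sum_div]

theorem permClass_univ : permClass Finset.univ σ = {σ} := by
  ext τ
  simp only [mem_permClass, Finset.mem_univ, forall_const, Finset.mem_singleton]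
  exact Equiv.ext_iff.symm

/-- Averages over two classes agree if a permutation of `Perm α` matches them. -/
theorem classAverage_eq_of_equiv {I' : Finset α} {σ' : Perm α} (e : Perm α ≃ Perm α)
    (he : ∀ τ, e τ ∈ permClass I' σ' ↔ τ ∈ permClass I σ) (X : Perm α → ℝ) :
    classAverage I' σ' X = classAverage I σ (fun τ => X (e τ)) := by
  have hmap : permClass I' σ' = (permClass I σ).map e.toEmbedding := by
    ext τ
    rw [Finset.mem_map_equiv, ← he, e.apply_symm_apply]
  rw [classAverage, classAverage, hmap, Finset.sum_map, Finset.card_map]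
  rfl

/-- The uniform average is the average of the averages over the classes of a partition. -/
theorem sum_classAverage (I : Perm α → Finset α)
    (hI : ∀ σ, ∀ τ ∈ permClass (I σ) σ, I τ = I σ) (X : Perm α → ℝ) :
    ∑ σ, classAverage (I σ) σ X = ∑ σ, X σ := by
  have key : ∀ σ τ, τ ∈ permClass (I σ) σ ↔ σ ∈ permClass (I τ) τ := by
    have : ∀ σ τ, τ ∈ permClass (I σ) σ → σ ∈ permClass (I τ) τ := by
      intro σ τ h
      rw [hI σ τ h, permClass_eq_of_mem h]
      exact self_mem_permClass
    exact fun σ τ => ⟨this σ τ, this τ σ⟩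
  have hcard : ∀ σ, ∀ τ ∈ permClass (I σ) σ, permClass (I τ) τ = permClass (I σ) σ := by
    intro σ τ h
    rw [hI σ τ h, permClass_eq_of_mem h]
  -- Normalising by the class of `τ` itself gives each `X τ` total weight 1 once the sums are
  -- exchanged.
  have h1 : ∀ σ, classAverage (I σ) σ X =
      ∑ τ, if τ ∈ permClass (I σ) σ then X τ / (permClass (I τ) τ).card else 0 := by
    intro σ
    rw [classAverage, Finset.sum_div, ← Finset.sum_filter, Finset.filter_univ_mem]
    exact Finset.sum_congr rfl fun τ h => by rw [hcard σ τ h]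
  simp_rw [h1]
  rw [Finset.sum_comm]
  refine Finset.sum_congr rfl fun τ _ => ?_
  simp_rw [fun σ => key σ τ]
  rw [← Finset.sum_filter, Finset.filter_univ_mem, Finset.sum_const, nsmul_eq_mul]
  have := card_permClass_pos (I := I τ) (σ := τ)
  field_simp

theorem mul_swap_mem_permClass_iff {i j : α} (hi : i ∉ I) (hj : j ∉ I) :
    τ * swap i j ∈ permClass I σ ↔ τ ∈ permClass I σ := by
  simp only [mem_permClass, Perm.mul_apply]
  refine forall₂_congr fun a ha => ?_
  rw [swap_apply_of_ne_of_ne (by rintro rfl; exact hi ha) (by rintro rfl; exact hj ha)]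

/-- The subclass of `permClass I σ` in which the value `σ j` is taken at `i`. -/
theorem mem_permClass_insert_swap_iff {i j : α} (hi : i ∉ I) (hj : j ∉ I) :
    τ ∈ permClass (insert i I) (σ * swap i j) ↔ τ ∈ permClass I σ ∧ τ i = σ j := by
  rw [mem_permClass, Finset.forall_mem_insert, Perm.mul_apply, swap_apply_left, ← mem_permClass,
    and_comm, permClass_eq_of_mem ((mul_swap_mem_permClass_iff hi hj).2 self_mem_permClass)]

/-- Right multiplication by `swap i i'` moves the value `σ j` from `i` to `i'` and keeps the
restriction to `I`. -/
theorem classAverage_insert_swap_eq {i i' j : α} (hi : i ∉ I) (hi' : i' ∉ I) (hj : j ∉ I)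
    (X : Perm α → ℝ) :
    classAverage (insert i' I) (σ * swap i' j) X =
      classAverage (insert i I) (σ * swap i j) (fun τ => X (τ * swap i i')) :=
  classAverage_eq_of_equiv (Equiv.mulRight (swap i i')) (fun τ => by
    rw [Equiv.coe_mulRight, mem_permClass_insert_swap_iff hi' hj,
      mem_permClass_insert_swap_iff hi hj, mul_swap_mem_permClass_iff hi hi', Perm.mul_apply,
      swap_apply_right]) X

theorem permClass_insert_swap_subset {i j : α} (hi : i ∉ I) (hj : j ∉ I) :
    permClass (insert i I) (σ * swap i j) ⊆ permClass I σ :=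
  fun _ h => ((mem_permClass_insert_swap_iff hi hj).1 h).1

/-- Revealing the position of the value `σ j`. -/
theorem classAverage_eq_average_insert {j : α} (hj : j ∉ I) (X : Perm α → ℝ) :
    classAverage I σ X =
      (∑ i ∈ Iᶜ, classAverage (insert i I) (σ * swap i j) X) / (Iᶜ : Finset α).card := by
  have hsum : ∀ Y : Perm α → ℝ, ∑ τ ∈ permClass I σ, Y τ =
      ∑ i ∈ Iᶜ, ∑ τ ∈ permClass (insert i I) (σ * swap i j), Y τ := by
    intro Y
    rw [← Finset.sum_fiberwise_of_maps_to (t := Iᶜ) (g := fun τ : Perm α => τ.symm (σ j))]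
    · refine Finset.sum_congr rfl fun i hi => Finset.sum_congr ?_ fun _ _ => rfl
      ext τ
      rw [Finset.mem_filter, mem_permClass_insert_swap_iff (Finset.mem_compl.1 hi) hj,
        Equiv.symm_apply_eq, eq_comm (a := σ j)]
    · intro τ hτ
      rw [Finset.mem_compl]
      intro hmem
      have := mem_permClass.1 hτ _ hmem
      rw [Equiv.apply_symm_apply] at this
      exact hj (by rwa [← σ.injective this] at hmem)
  have hcard : ∀ i ∈ Iᶜ, ((permClass (insert i I) (σ * swap i j)).card : ℝ) =
      (permClass (insert j I) (σ * swap j j)).card := by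
    intro i hi
    rw [Finset.mem_compl] at hi
    norm_cast
    refine (Finset.card_equiv (Equiv.mulRight (swap j i)) fun τ => ?_).symm
    rw [Equiv.coe_mulRight, mem_permClass_insert_swap_iff hi hj,
      mem_permClass_insert_swap_iff hj hj, mul_swap_mem_permClass_iff hj hi, Perm.mul_apply,
      swap_apply_right]
  set c : ℝ := ((permClass (insert j I) (σ * swap j j)).card : ℝ) with hc
  have hcI : ((permClass I σ).card : ℝ) = (Iᶜ : Finset α).card * c := by
    have := hsum fun _ => 1
    simp only [Finset.sum_const, nsmul_eq_mul, mul_one] at this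
    rw [this, Finset.sum_congr rfl hcard, Finset.sum_const, nsmul_eq_mul]
  rw [Finset.sum_congr rfl fun i hi => by rw [classAverage, hcard i hi], ← Finset.sum_div,
    classAverage, hsum, hcI, div_div, mul_comm c]

/-- A Shearer type inequality for permutations, in its dual (Brascamp-Lieb) form: the functions
`g d` depend only on the restriction of the permutation to `A d`, and no point is contained in more
than `k` of these sets. -/
theorem log_classAverage_exp_sum_le {D : Type*} [Fintype D] (A : D → Finset α)
    (g : D → Perm α → ℝ) {k : ℝ} (hk : 0 < k)
    (hcov : ∀ i, ((Finset.univ.filter fun d => i ∈ A d).card : ℝ) ≤ k) (I : Finset α) :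
    ∀ σ : Perm α, (∀ d, ∀ τ ∈ permClass I σ, ∀ ρ ∈ permClass I σ, (∀ i ∈ A d, τ i = ρ i) →
      g d τ = g d ρ) →
    Real.log (classAverage I σ fun τ => Real.exp ((∑ d, g d τ) / (2 * k))) ≤
      (∑ d, Real.log (classAverage I σ fun τ => Real.exp (g d τ))) / (2 * k) := by
  induction hn : (Iᶜ : Finset α).card generalizing I with
  | zero =>
    intro σ _
    rw [Finset.card_eq_zero, Finset.compl_eq_empty_iff] at hn
    subst hn
    simp [classAverage, permClass_univ]
  | succ n ih =>
    intro σ hg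
    have hne : (Iᶜ : Finset α).Nonempty := Finset.card_pos.1 (by omega)
    obtain ⟨j, hj⟩ := id hne
    rw [Finset.mem_compl] at hj
    -- `i` is the position of the value `σ j`. Positions are revealed rather than values so that,
    -- when `i` and `i'` both lie off `A d`, swapping them leaves `g d` unchanged and `L d` is
    -- constant there.
    set L : D → α → ℝ := fun d i => Real.log
      (classAverage (insert i I) (σ * swap i j) fun τ => Real.exp (g d τ)) with hL
    have hexpL : ∀ d i, Real.exp (L d i) =
        classAverage (insert i I) (σ * swap i j) fun τ => Real.exp (g d τ) :=
      fun d i => Real.exp_log (classAverage_pos fun _ => Real.exp_pos _)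
    have hbase := log_average_exp_sum_le hne A L (by
      intro d i hi i' hi' hiA hiA'
      rw [Finset.mem_compl] at hi hi'
      simp only [hL]
      rw [classAverage_insert_swap_eq hi hi' hj]
      congr 1
      refine classAverage_congr fun τ hτ => ?_
      have hτ' := permClass_insert_swap_subset hi hj hτ
      rw [hg d τ hτ' (τ * swap i i') ((mul_swap_mem_permClass_iff hi hi').2 hτ')]
      intro a ha
      rw [Perm.mul_apply, swap_apply_of_ne_of_ne (by rintro rfl; exact hiA ha)
        (by rintro rfl; exact hiA' ha)]) hk (fun i _ => hcov i)
    simp only [hexpL, ← classAverage_eq_average_insert hj] at hbase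
    refine le_trans (Real.log_le_log (classAverage_pos fun _ => Real.exp_pos _) ?_) hbase
    rw [classAverage_eq_average_insert hj]
    gcongr with i hi
    rw [Finset.mem_compl] at hi
    rw [← Real.log_le_iff_le_exp (classAverage_pos fun _ => Real.exp_pos _)]
    refine ih (insert i I) ?_ _ ?_
    · rw [Finset.card_compl, Finset.card_insert_of_notMem hi]
      rw [Finset.card_compl] at hn
      omega
    · exact fun d τ hτ ρ hρ => hg d τ (permClass_insert_swap_subset hi hj hτ) ρ
        (permClass_insert_swap_subset hi hj hρ)

end PermClass

/-! ### Positions read by an algorithm -/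

namespace PCGame

open Equiv

variable {N : ℕ} {D M V : Type*}

/-- The position of the permutation which is revealed by an inner query. -/
def innerPosition (σ : Perm (Fin N)) : PCQuery N M → Option (Fin N)
  | .inner i => some i
  | .inverse j => some (σ.symm j)
  | .outer _ => none

open Classical in
/-- The positions of the permutation which are revealed by the inner queries of `B`. -/
noncomputable def revealed (B : NonadaptiveAlg N M V) (σ : Perm (Fin N)) : Finset (Fin N) :=
  Finset.univ.filter fun i => ∃ t, innerPosition σ (B.query t) = some i

open Classical in
/-- The positions of the permutation which are read by the outer queries of `B`, for the secret
`d`. -/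
noncomputable def outerPositions (G : PCGame N D M V) (B : NonadaptiveAlg N M V) (d : D) :
    Finset (Fin N) :=
  Finset.univ.filter fun i => ∃ t m, B.query t = .outer m ∧ G.tr d m = i

/-- The indicator of success. -/
def success (G : PCGame N D M V) (B : NonadaptiveAlg N M V) (d : D) (σ : Perm (Fin N)) : ℝ :=
  if G.succeeds B σ d = true then 1 else 0

variable {G : PCGame N D M V} {B : NonadaptiveAlg N M V} {σ τ ρ : Perm (Fin N)} {d : D}

theorem mem_revealed {i : Fin N} :
    i ∈ revealed B σ ↔ ∃ t, innerPosition σ (B.query t) = some i := by simp [revealed]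

theorem mem_outerPositions {i : Fin N} :
    i ∈ G.outerPositions B d ↔ ∃ t m, B.query t = .outer m ∧ G.tr d m = i := by
  simp [outerPositions]

theorem success_nonneg : 0 ≤ G.success B d σ := by
  unfold success; split_ifs <;> norm_num

theorem success_le_one : G.success B d σ ≤ 1 := by
  unfold success; split_ifs <;> norm_num

theorem exp_mul_success (l : ℝ) :
    Real.exp (l * G.success B d σ) = 1 + G.success B d σ * (Real.exp l - 1) := by
  unfold success; split_ifs <;> simp

theorem success_congr (h : G.answers B σ d = G.answers B τ d) :
    G.success B d σ = G.success B d τ := by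
  unfold success succeeds; rw [h]

/-- An inverse query on `j` reveals the position `σ.symm j`; a permutation agreeing with `σ` there
also sends it to `j`. Hence the sets `revealed B σ`, though they depend on `σ`, define a partition.
-/
theorem innerPosition_eq_of_mem (h : τ ∈ permClass (revealed B σ) σ) (t : Fin B.numQueries) :
    innerPosition τ (B.query t) = innerPosition σ (B.query t) := by
  rw [mem_permClass] at h
  rcases hq : B.query t with i | j | m
  · rfl
  · have := h (σ.symm j) (mem_revealed.2 ⟨t, by rw [hq]; rfl⟩)
    rw [Equiv.apply_symm_apply] at this
    simp only [innerPosition]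
    rw [(Equiv.symm_apply_eq τ).2 this.symm]
  · rfl

theorem revealed_eq_of_mem (h : τ ∈ permClass (revealed B σ) σ) :
    revealed B τ = revealed B σ := by
  ext i
  simp only [mem_revealed, innerPosition_eq_of_mem h]

theorem answers_eq_of_mem (hpost : G.TrivialPost) (hτ : τ ∈ permClass (revealed B σ) σ)
    (hρ : ρ ∈ permClass (revealed B σ) σ) (h : ∀ i ∈ G.outerPositions B d, τ i = ρ i) :
    G.answers B τ d = G.answers B ρ d := by
  funext t
  have h1 := innerPosition_eq_of_mem hτ t
  have h2 := innerPosition_eq_of_mem hρ t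
  rw [mem_permClass] at hτ hρ
  unfold answers
  rcases hq : B.query t with i | j | m
  · have hi : i ∈ revealed B σ := mem_revealed.2 ⟨t, by rw [hq]; rfl⟩
    simp only [answer]
    rw [hτ i hi, hρ i hi]
  · rw [hq] at h1 h2
    exact Option.some_injective _ (h1.trans h2.symm)
  · simp only [answer]
    rw [hpost, hpost]
    exact h _ (mem_outerPositions.2 ⟨t, m, hq, rfl⟩)

section Sums

variable [Fintype D]

theorem card_filter_eq_sum_success (f : Perm (Fin N) → NonadaptiveAlg N M V) :
    ((Finset.univ.filter fun x : Perm (Fin N) × D => G.succeeds (f x.1) x.1 x.2 = true).card : ℝ) =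
      ∑ σ, ∑ d, G.success (f σ) d σ := by
  rw [Finset.card_filter]
  push_cast
  rw [← Finset.univ_product_univ, Finset.sum_product]
  rfl

theorem successProb_eq : G.successProb B =
    (∑ σ, ∑ d, G.success B d σ) / (Fintype.card (Perm (Fin N)) * Fintype.card D) := by
  rw [successProb, card_filter_eq_sum_success (fun _ => B), Fintype.card_prod, Nat.cast_mul]

theorem successProb_nonneg : 0 ≤ G.successProb B := by
  unfold successProb; positivity

theorem successProb_le_one : G.successProb B ≤ 1 := by
  unfold successProb
  refine div_le_one_of_le₀ ?_ (Nat.cast_nonneg _)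
  exact_mod_cast Finset.card_le_univ _

theorem maxS_nonneg (T : ℕ) : 0 ≤ G.maxS T :=
  Real.sSup_nonneg (by rintro _ ⟨B, _, rfl⟩; exact successProb_nonneg)

theorem successProb_le_maxS {T : ℕ} (hB : G.IsAlg T B) : G.successProb B ≤ G.maxS T :=
  le_csSup ⟨1, by rintro _ ⟨B, _, rfl⟩; exact successProb_le_one⟩ ⟨B, hB, rfl⟩

theorem card_mem_outerPositions_le {u : ℝ} (hu : 0 < u) (huniform : G.IsUniform u) {T : ℕ}
    (hB : G.IsAlg T B) (i : Fin N) :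
    ((Finset.univ.filter fun d => i ∈ G.outerPositions B d).card : ℝ) ≤
      T * (Fintype.card D / u) := by
  classical
  have hsub : (Finset.univ.filter fun d => i ∈ G.outerPositions B d) ⊆
      Finset.univ.biUnion fun t : Fin B.numQueries =>
        Finset.univ.filter fun d => ∃ m, B.query t = .outer m ∧ G.tr d m = i := by
    intro d hd
    simpa [mem_outerPositions] using hd
  have hc : 0 ≤ (Fintype.card D : ℝ) / u := by positivity
  calc ((Finset.univ.filter fun d => i ∈ G.outerPositions B d).card : ℝ)
      ≤ ∑ t : Fin B.numQueries,
          ((Finset.univ.filter fun d => ∃ m, B.query t = .outer m ∧ G.tr d m = i).card : ℝ) := by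
        exact_mod_cast (Finset.card_le_card hsub).trans Finset.card_biUnion_le
    _ ≤ ∑ _t : Fin B.numQueries, (Fintype.card D : ℝ) / u := by
        refine Finset.sum_le_sum fun t _ => ?_
        rcases hq : B.query t with a | a | m
        · simpa using hc
        · simpa using hc
        · simpa using huniform m i
    _ = B.numQueries * (Fintype.card D / u) := by simp
    _ ≤ _ := by
        have : (B.numQueries : ℝ) ≤ T := by exact_mod_cast hB.1
        gcongr

end Sums

/-! ### Simulating a conditioned permutation by relabelling values -/

section Relabel

/-- A permutation `τ` of the values such that `τ * σ` agrees with `σ₀` on `I`; it depends only on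
the restriction of `σ` to `I`. -/
noncomputable def relabel (I : Finset (Fin N)) (σ₀ σ : Perm (Fin N)) : Perm (Fin N) :=
  Classical.epsilon fun τ => ∀ i ∈ I, τ (σ i) = σ₀ i

theorem relabel_spec (I : Finset (Fin N)) (σ₀ σ : Perm (Fin N)) :
    ∀ i ∈ I, relabel I σ₀ σ (σ i) = σ₀ i :=
  Classical.epsilon_spec (p := fun τ : Perm (Fin N) => ∀ i ∈ I, τ (σ i) = σ₀ i)
    ⟨σ₀ * σ⁻¹, fun i _ => by simp⟩

theorem relabel_eq_of_mem {I : Finset (Fin N)} (σ₀ : Perm (Fin N)) (h : τ ∈ permClass I σ) :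
    relabel I σ₀ τ = relabel I σ₀ σ := by
  rw [mem_permClass] at h
  unfold relabel
  congr 1
  funext ρ
  exact propext (forall₂_congr fun i hi => by rw [h i hi])

theorem relabel_mul_mem_permClass_iff (I : Finset (Fin N)) (σ₀ : Perm (Fin N)) :
    relabel I σ₀ σ * τ ∈ permClass I σ₀ ↔ τ ∈ permClass I σ := by
  simp only [mem_permClass, Perm.mul_apply]
  refine forall₂_congr fun i hi => ?_
  rw [← relabel_spec I σ₀ σ i hi, EmbeddingLike.apply_eq_iff_eq]

/-- The query which reads the same position of `σ₀` without using the inverse. -/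
def forwardQuery (σ₀ : Perm (Fin N)) : PCQuery N M → PCQuery N M
  | .inner i => .inner i
  | .inverse j => .inner (σ₀.symm j)
  | .outer m => .outer m

/-- The answer to a query which is computed from the answer `a` to its forward version. -/
def recoverAnswer (σ₀ τ : Perm (Fin N)) : PCQuery N M → Fin N → Fin N
  | .inner _, a => τ a
  | .inverse j, _ => σ₀.symm j
  | .outer _, a => τ a

/-- The algorithm which runs `B` after relabelling the values in such a way that the inner queries
of `B` are answered as for the permutation `σ₀`. -/
noncomputable def relabelledAlg (B : NonadaptiveAlg N M V) (σ₀ : Perm (Fin N)) :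
    NonadaptiveAlg N M V where
  numQueries := B.numQueries
  query t := forwardQuery σ₀ (B.query t)
  output b := B.output fun t => recoverAnswer σ₀
    (Classical.epsilon fun τ : Perm (Fin N) => ∀ t i, innerPosition σ₀ (B.query t) = some i →
      τ (b t) = σ₀ i) (B.query t) (b t)

theorem isAlg_relabelledAlg {T : ℕ} (hB : G.IsAlg T B) (σ₀ : Perm (Fin N)) :
    G.IsAlg T (relabelledAlg B σ₀) := by
  refine ⟨hB.1, fun t j h => ?_⟩
  change forwardQuery σ₀ (B.query t) = _ at h
  rcases hq : B.query t with i | i | m <;> rw [hq] at h <;> cases h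

theorem output_relabelledAlg (hpost : G.TrivialPost) (σ₀ : Perm (Fin N)) :
    (relabelledAlg B σ₀).output (G.answers (relabelledAlg B σ₀) σ d) =
      B.output (G.answers B (relabel (revealed B σ₀) σ₀ σ * σ) d) := by
  have hin : ∀ (t : Fin B.numQueries) (i : Fin N), innerPosition σ₀ (B.query t) = some i →
      G.answers (relabelledAlg B σ₀) σ d t = σ i := by
    intro t i h
    change G.answer σ d (forwardQuery σ₀ (B.query t)) = _
    rcases hq : B.query t with a | a | m <;> rw [hq] at h <;> cases h <;> rfl
  have heps : (Classical.epsilon fun τ : Perm (Fin N) => ∀ (t : Fin B.numQueries) (i : Fin N),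
      innerPosition σ₀ (B.query t) = some i →
        τ (G.answers (relabelledAlg B σ₀) σ d t) = σ₀ i) = relabel (revealed B σ₀) σ₀ σ := by
    unfold relabel
    congr 1
    funext τ
    refine propext ⟨fun h i hi => ?_, fun h t i hi => ?_⟩
    · obtain ⟨t, ht⟩ := mem_revealed.1 hi
      rw [← hin t i ht]
      exact h t i ht
    · rw [hin t i hi]
      exact h i (mem_revealed.2 ⟨t, hi⟩)
  change B.output _ = _
  congr 1
  funext t
  rw [heps]
  have hspec := relabel_spec (revealed B σ₀) σ₀ σ
  change recoverAnswer σ₀ _ (B.query t) (G.answer σ d (forwardQuery σ₀ (B.query t))) =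
    G.answer _ d (B.query t)
  rcases hq : B.query t with i | j | m
  · rfl
  · change σ₀.symm j = (relabel (revealed B σ₀) σ₀ σ * σ).symm j
    rw [eq_comm, Equiv.symm_apply_eq, Perm.mul_apply,
      hspec _ (mem_revealed.2 ⟨t, by rw [hq]; rfl⟩), Equiv.apply_symm_apply]
  · change relabel _ _ _ (G.post d _) = G.post d _
    rw [hpost, hpost, Perm.mul_apply]

theorem success_relabelledAlg (hpost : G.TrivialPost) (hsuc : G.ComparesOutputWithSecret)
    (σ₀ : Perm (Fin N)) :
    G.success (relabelledAlg B σ₀) d σ =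
      G.success B d (relabel (revealed B σ₀) σ₀ σ * σ) := by
  obtain ⟨P, hP⟩ := hsuc
  unfold success succeeds
  rw [hP, hP, output_relabelledAlg hpost]

/-- Conditioned on the answers to the inner queries, the success probability is at most
`MaxS(T)`. -/
theorem sum_classAverage_success_le [Fintype D] [Nonempty D] (hpost : G.TrivialPost)
    (hsuc : G.ComparesOutputWithSecret) {T : ℕ} (hB : G.IsAlg T B) (σ₀ : Perm (Fin N)) :
    ∑ d, classAverage (revealed B σ₀) σ₀ (G.success B d) ≤ Fintype.card D * G.maxS T := by
  have hD : (0 : ℝ) < Fintype.card D := by exact_mod_cast Fintype.card_pos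
  have hP : (0 : ℝ) < Fintype.card (Perm (Fin N)) := by exact_mod_cast Fintype.card_pos
  have h := successProb_le_maxS (isAlg_relabelledAlg hB σ₀)
  set I := revealed B σ₀ with hI
  -- On each class the relabelling is one fixed permutation, which maps the class bijectively onto
  -- that of `σ₀`. So the simulation has the conditional success probability on every class.
  have hcls : ∀ σ, classAverage I σ (fun τ => ∑ d, G.success B d (relabel I σ₀ τ * τ)) =
      ∑ d, classAverage I σ₀ (G.success B d) := by
    intro σ
    rw [← classAverage_sum, classAverage_eq_of_equiv (Equiv.mulLeft (relabel I σ₀ σ))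
      (fun τ => relabel_mul_mem_permClass_iff I σ₀)]
    exact classAverage_congr fun τ hτ => by rw [relabel_eq_of_mem σ₀ hτ]; rfl
  rw [successProb_eq] at h
  simp only [success_relabelledAlg hpost hsuc, ← hI] at h
  rw [← sum_classAverage (fun _ => I) (fun _ _ _ => rfl), Finset.sum_congr rfl fun σ _ => hcls σ,
    Finset.sum_const, Finset.card_univ, nsmul_eq_mul, mul_div_mul_left _ _ hP.ne',
    div_le_iff₀ hD] at h
  linarith

end Relabel

/-! ### Exponential moments and the cost of advice -/

section Preprocessing

variable [Fintype D] [Nonempty D]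

/-- A bound on the exponential moment of the number of secrets for which an algorithm succeeds. -/
theorem sum_exp_sum_success_le (hpost : G.TrivialPost) (hsuc : G.ComparesOutputWithSecret)
    {u : ℝ} (hu : 0 < u) (huniform : G.IsUniform u) {T : ℕ} (hB : G.IsAlg T B) {k l a b : ℝ}
    (hk : 0 < k) (hTk : T * (Fintype.card D / u) ≤ k) (ha : 0 ≤ a)
    (hab : ∀ q : ℝ, 0 ≤ q → q ≤ 1 → Real.log (1 + q * (Real.exp l - 1)) ≤ a * q + b) :
    ∑ σ, Real.exp ((∑ d, l * G.success B d σ) / (2 * k)) ≤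
      Fintype.card (Perm (Fin N)) *
        Real.exp (Fintype.card D * (a * G.maxS T + b) / (2 * k)) := by
  rw [← sum_classAverage (revealed B) (fun _ _ => revealed_eq_of_mem), ← Finset.card_univ,
    ← nsmul_eq_mul]
  refine Finset.sum_le_card_nsmul _ _ _ fun σ _ => ?_
  rw [← Real.log_le_iff_le_exp (classAverage_pos fun _ => Real.exp_pos _)]
  refine (log_classAverage_exp_sum_le (G.outerPositions B) (fun d τ => l * G.success B d τ) hk
    (fun i => (card_mem_outerPositions_le hu huniform hB i).trans hTk) _ σ
    (fun d τ hτ ρ hρ h => by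
      simp only [success_congr (answers_eq_of_mem hpost hτ hρ h)])).trans ?_
  gcongr
  have hq : ∀ d, Real.log (classAverage (revealed B σ) σ
      fun τ => Real.exp (l * G.success B d τ)) ≤
        a * classAverage (revealed B σ) σ (G.success B d) + b := by
    intro d
    have h0 : 0 ≤ classAverage (revealed B σ) σ (G.success B d) := by
      rw [← classAverage_const (I := revealed B σ) (σ := σ) 0]
      exact classAverage_mono fun _ _ => success_nonneg
    have h1 : classAverage (revealed B σ) σ (G.success B d) ≤ 1 := by
      rw [← classAverage_const (I := revealed B σ) (σ := σ) 1]
      exact classAverage_mono fun _ _ => success_le_one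
    refine le_trans (le_of_eq ?_) (hab _ h0 h1)
    congr 1
    have hc := card_permClass_pos (I := revealed B σ) (σ := σ)
    simp only [exp_mul_success, classAverage, Finset.sum_add_distrib, ← Finset.sum_mul,
      Finset.sum_const, nsmul_eq_mul, mul_one]
    field_simp
  refine (Finset.sum_le_sum fun d _ => hq d).trans ?_
  rw [Finset.sum_add_distrib, ← Finset.mul_sum, Finset.sum_const, Finset.card_univ, nsmul_eq_mul]
  have := mul_le_mul_of_nonneg_left (sum_classAverage_success_le hpost hsuc hB σ) ha
  linarith

theorem mul_preprocessingSuccessProb_le (hpost : G.TrivialPost)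
    (hsuc : G.ComparesOutputWithSecret) {u : ℝ} (hu : 0 < u) (huniform : G.IsUniform u) {S T : ℕ}
    {A : PreprocessingAlg N S M V} (hA : G.IsPreprocessingAlg T A) {ε l a b : ℝ} (hε : 0 < ε)
    (ha : 0 ≤ a)
    (hab : ∀ q : ℝ, 0 ≤ q → q ≤ 1 → Real.log (1 + q * (Real.exp l - 1)) ≤ a * q + b) :
    l * G.preprocessingSuccessProb A ≤
      2 * (T / u + ε) * (S * Real.log 2) + a * G.maxS T + b := by
  have hD : (0 : ℝ) < Fintype.card D := by exact_mod_cast Fintype.card_pos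
  have hP : (0 : ℝ) < Fintype.card (Perm (Fin N)) := by exact_mod_cast Fintype.card_pos
  -- The `ε` keeps `k` positive when `T = 0`; it is sent to 0 afterwards.
  set κ : ℝ := T / u + ε with hκ
  have hκ0 : 0 < κ := by positivity
  set k : ℝ := κ * Fintype.card D with hkdef
  have hk : 0 < k := by positivity
  have hTk : T * (Fintype.card D / u) ≤ k := by
    have : k = T * (Fintype.card D / u) + ε * Fintype.card D := by
      rw [hkdef, hκ]; field_simp
    rw [this]
    have := mul_pos hε hD
    linarith
  set Λ : ℝ := Fintype.card D * (a * G.maxS T + b) / (2 * k) with hΛ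
  set Y : (Fin S → Bool) → Perm (Fin N) → ℝ :=
    fun z σ => (∑ d, l * G.success (A.online z) d σ) / (2 * k) with hY
  have hz : ∀ z, ∑ σ, Real.exp (Y z σ) ≤ Fintype.card (Perm (Fin N)) * Real.exp Λ :=
    fun z => sum_exp_sum_success_le hpost hsuc hu huniform (hA z) hk hTk ha hab
  have hunion : ∑ σ, Real.exp (Y (A.advice σ) σ) ≤
      2 ^ S * (Fintype.card (Perm (Fin N)) * Real.exp Λ) := by
    calc ∑ σ, Real.exp (Y (A.advice σ) σ) ≤ ∑ σ, ∑ z, Real.exp (Y z σ) :=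
          Finset.sum_le_sum fun σ _ => Finset.single_le_sum (f := fun z => Real.exp (Y z σ))
            (fun _ _ => (Real.exp_pos _).le) (Finset.mem_univ _)
      _ = ∑ z, ∑ σ, Real.exp (Y z σ) := Finset.sum_comm
      _ ≤ ∑ _z : Fin S → Bool, Fintype.card (Perm (Fin N)) * Real.exp Λ :=
          Finset.sum_le_sum fun z _ => hz z
      _ = _ := by simp
  have hJ := convexOn_exp.map_sum_le (t := Finset.univ)
    (w := fun _ : Perm (Fin N) => (Fintype.card (Perm (Fin N)) : ℝ)⁻¹)
    (p := fun σ => Y (A.advice σ) σ) (fun _ _ => by positivity)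
    (by rw [Finset.sum_const, Finset.card_univ, nsmul_eq_mul, mul_inv_cancel₀ hP.ne'])
    (fun _ _ => Set.mem_univ _)
  simp only [smul_eq_mul, ← Finset.mul_sum] at hJ
  have hexp : Real.exp ((Fintype.card (Perm (Fin N)) : ℝ)⁻¹ * ∑ σ, Y (A.advice σ) σ) ≤
      Real.exp (S * Real.log 2 + Λ) := by
    refine hJ.trans ?_
    rw [Real.exp_add, mul_comm (S : ℝ), Real.exp_mul, Real.exp_log two_pos, Real.rpow_natCast,
      inv_mul_le_iff₀ hP]
    linarith
  rw [Real.exp_le_exp] at hexp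
  have hprob : (Fintype.card (Perm (Fin N)) : ℝ)⁻¹ * ∑ σ, Y (A.advice σ) σ =
      l * G.preprocessingSuccessProb A / (2 * κ) := by
    rw [preprocessingSuccessProb, card_filter_eq_sum_success (fun σ => A.online (A.advice σ)),
      Fintype.card_prod, Nat.cast_mul, hY, hkdef]
    simp only [← Finset.sum_div, ← Finset.mul_sum]
    field_simp
  have hΛ' : Λ = (a * G.maxS T + b) / (2 * κ) := by
    rw [hΛ, hkdef]; field_simp
  rw [hprob, hΛ', div_le_iff₀ (by positivity), add_mul, div_mul_cancel₀ _ (by positivity)] at hexp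
  linarith

theorem mul_preprocessingSuccessProb_le' (hpost : G.TrivialPost)
    (hsuc : G.ComparesOutputWithSecret) {u : ℝ} (hu : 0 < u) (huniform : G.IsUniform u) {S T : ℕ}
    {A : PreprocessingAlg N S M V} (hA : G.IsPreprocessingAlg T A) {l a b : ℝ} (ha : 0 ≤ a)
    (hab : ∀ q : ℝ, 0 ≤ q → q ≤ 1 → Real.log (1 + q * (Real.exp l - 1)) ≤ a * q + b) :
    l * G.preprocessingSuccessProb A ≤
      2 * (Real.log 2 * S * T / u) + a * G.maxS T + b := by
  have hlog := Real.log_pos one_lt_two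
  refine le_of_forall_pos_le_add fun δ hδ => ?_
  have h := mul_preprocessingSuccessProb_le hpost hsuc hu huniform hA
    (ε := δ / (2 * (S * Real.log 2) + 1)) (by positivity) ha hab
  have h2 : δ / (2 * (S * Real.log 2) + 1) * (2 * (S * Real.log 2) + 1) = δ :=
    div_mul_cancel₀ _ (by positivity)
  have h3 : 0 < δ / (2 * (S * Real.log 2) + 1) := by positivity
  have h4 : 2 * (T / u + δ / (2 * (S * Real.log 2) + 1)) * (S * Real.log 2) =
      2 * (Real.log 2 * S * T / u) +
        δ / (2 * (S * Real.log 2) + 1) * (2 * (S * Real.log 2)) := by ring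
  linarith

end Preprocessing

end PCGame

/-! ### Choice of the parameter `l` -/

theorem theoremF1 {N : ℕ} (hN : 0 < N) {D M V : Type*} [Fintype D] [Nonempty D]
    (G : PCGame N D M V) (u : ℝ) (hu : 0 < u) (huniform : G.IsUniform u)
    (hpost : G.TrivialPost) (hsuc : G.ComparesOutputWithSecret)
    (S T : ℕ) (A : PreprocessingAlg N S M V) (hA : G.IsPreprocessingAlg T A) :
    G.preprocessingSuccessProb A ≤
      min (2 * G.maxS T + 4 * Real.log 2 * (S : ℝ) * (T : ℝ) / u)
        (G.maxS T + Real.sqrt (Real.log 2 * (S : ℝ) * (T : ℝ) / u)) := by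
  have hlog := Real.log_pos one_lt_two
  have hK : 0 ≤ Real.log 2 * (S : ℝ) * (T : ℝ) / u := by positivity
  refine le_min ?_ ?_
  · have he : 1 < Real.exp 1 := Real.one_lt_exp_iff.2 one_pos
    -- With `l = 1`, `log (1 + t) ≤ t` allows `a = e - 1 ≤ 2` and `b = 0`. The additive term
    -- obtained is half of the one claimed.
    have h := PCGame.mul_preprocessingSuccessProb_le' hpost hsuc hu huniform hA (l := 1)
      (a := Real.exp 1 - 1) (b := 0) (by linarith) (fun q hq _ => by
        have hpos : 0 < 1 + q * (Real.exp 1 - 1) := by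
          have := mul_nonneg hq (sub_nonneg.2 he.le)
          linarith
        linarith [Real.log_le_sub_one_of_pos hpos])
    have h1 : (Real.exp 1 - 1) * G.maxS T ≤ 2 * G.maxS T :=
      mul_le_mul_of_nonneg_right (by linarith [Real.exp_one_lt_d9]) (PCGame.maxS_nonneg T)
    have h2 : 4 * Real.log 2 * (S : ℝ) * (T : ℝ) / u =
        4 * (Real.log 2 * (S : ℝ) * (T : ℝ) / u) := by ring
    linarith
  · have h : ∀ l : ℝ, 0 < l → l * G.preprocessingSuccessProb A ≤
        2 * (Real.log 2 * S * T / u) + l * G.maxS T + l ^ 2 / 8 := fun l hl =>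
      PCGame.mul_preprocessingSuccessProb_le' hpost hsuc hu huniform hA hl.le
        fun q h0 h1 => log_one_add_mul_exp_sub_one_le h0 h1
    have hr := Real.sq_sqrt hK
    set r := Real.sqrt (Real.log 2 * (S : ℝ) * (T : ℝ) / u) with hrdef
    rw [← hr] at h
    have hr0 : 0 ≤ r := Real.sqrt_nonneg _
    clear_value r
    rcases hr0.eq_or_lt with h0 | h0
    · refine le_of_forall_pos_le_add fun δ hδ => ?_
      -- For `r = 0` the optimal `l` would be 0; dividing by a small `l` leaves the error `l / 8 =
      -- δ`.
      have := h (8 * δ) (by linarith)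
      rw [← h0] at this ⊢
      nlinarith
    -- `l = 4 * r` minimises `2 * r ^ 2 / l + l / 8`, with minimum `r`.
    · have := h (4 * r) (by linarith)
      nlinarith
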